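/- Let $K$ be a Polish space. Let $\operatorname{DSC}(K)$ be the class of functions $g:K\to\mathbb R$ for which there are continuous functions $g_n:K\to\mathbb R$ $(n\ge 1)$ with $g_n\to g$ pointwise and $\sum_{n}|g_{n+1}(x)-g_n(x)|<\infty$ for every $x\in K$. For a topological space $X$ and $g:X\to[0,\infty]$ put $(\mathbf U g)(x)=\limsup_{y\to x}g(y)=\inf_V\sup_{y\in V}g(y)$, the infimum being over all open neighborhoods $V$ of $x$ (so $y=x$ is allowed). For $f:X\to\mathbb R$ the transfinite oscillations $\operatorname{osc}_\alpha f:X\to[0,\infty]$ are defined by recursion on the ordinal $\alpha$: $\operatorname{osc}_0 f=0$; and, for $\beta>0$, $\operatorname{osc}_\beta f=\mathbf U(\widetilde{\operatorname{osc}}_\beta f)$, where $\widetilde{\operatorname{osc}}_{\alpha+1}f(x)=\limsup_{y\to x}\bigl(|f(y)-f(x)|+\operatorname{osc}_\alpha f(y)\bigr)$ (with the same convention) and $\widetilde{\operatorname{osc}}_\beta f=\sup_{\alpha<\beta}\operatorname{osc}_\alpha f$ if $\beta$ is a limit ordinal. For a subset $U\subseteq K$, $\operatorname{osc}_\alpha(g|U)$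 is computed in the space $U$ with the subspace topology. **Theorem.** Let $f:K\to\mathbb R$ be a function and let $f_1,f_2,\dots$ be functions in $\operatorname{DSC}(K)$. Suppose that for every countable ordinal $\alpha$ and every non-empty closed set $L\subseteq K$ there are a subsequence $(f'_j)$ of $(f_j)$ and a closed set $U\subseteq L$ with non-empty interior relative to $L$ such that (i) $f'_j\to f$ uniformly on $U$, and (ii) $\sum_j\bigl\|\operatorname{osc}_\alpha\bigl((f'_{j+1}-f'_j)|U\bigr)\bigr\|_\infty<\infty$, where $\|\cdot\|_\infty$ is the supremum over $U$. Then $f\in\operatorname{DSC}(K)$. -/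

import Mathlib

open Filter Topology

noncomputable section

/-- `DSC(X)`: the real functions `f` on `X` that are the pointwise limit of a sequence of continuous
real functions `g n` with `∑ₙ |g (n+1) x - g n x| < ∞` at every point `x`. -/
def DSC (X : Type*) [TopologicalSpace X] : Set (X → ℝ) :=
  {f | ∃ g : ℕ → C(X, ℝ),
    (∀ x, Tendsto (fun n => g n x) atTop (𝓝 (f x))) ∧
    ∀ x, Summable (fun n => |g (n + 1) x - g n x|)}

/-- The upper semicontinuous envelope `(𝐔 g)(x) = limsup_{y → x} g y` of a `[0, ∞]`-valued function.
The limit superior is unrestricted: `y = x` is allowed (see `usEnv_eq_iInf`). -/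
def usEnv {X : Type*} [TopologicalSpace X] (g : X → ENNReal) (x : X) : ENNReal :=
  limsup g (𝓝 x)

theorem usEnv_eq_iInf {X : Type*} [TopologicalSpace X] (g : X → ENNReal) (x : X) :
    usEnv g x = ⨅ V : {V : Set X // x ∈ V ∧ IsOpen V}, ⨆ y ∈ V.1, g y := by
  rw [usEnv, (nhds_basis_opens x).limsup_eq_iInf_iSup, iInf_subtype]

/-- The transfinite oscillations `osc_α f : X → [0, ∞]` of a real function `f` on `X`:
`osc_0 f = 0`; `osc_{α+1} f` is the upper semicontinuous envelope of
`x ↦ limsup_{y → x} (|f y - f x| + osc_α f y)`; for a limit ordinal `β`, `osc_β f` is the upper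
semicontinuous envelope of `sup_{α < β} osc_α f`. -/
def transOsc {X : Type*} [TopologicalSpace X] (f : X → ℝ) (α : Ordinal.{0}) : X → ENNReal :=
  Ordinal.limitRecOn (motive := fun _ => X → ENNReal) α
    (fun _ => 0)
    (fun _ o => usEnv fun x => usEnv (fun y => ENNReal.ofReal |f y - f x| + o y) x)
    (fun β _ o => usEnv fun x => ⨆ (α : Ordinal.{0}) (h : α < β), o α h x)

theorem transOsc_zero {X : Type*} [TopologicalSpace X] (f : X → ℝ) :
    transOsc f 0 = fun _ => 0 := by
  rw [transOsc, Ordinal.limitRecOn_zero]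

theorem transOsc_add_one {X : Type*} [TopologicalSpace X] (f : X → ℝ) (α : Ordinal.{0}) :
    transOsc f (α + 1) =
      usEnv fun x => usEnv (fun y => ENNReal.ofReal |f y - f x| + transOsc f α y) x := by
  rw [transOsc, Ordinal.limitRecOn_add_one]
  rfl

theorem transOsc_limit {X : Type*} [TopologicalSpace X] (f : X → ℝ) (β : Ordinal.{0})
    (hβ : Order.IsSuccLimit β) :
    transOsc f β = usEnv fun x => ⨆ (α : Ordinal.{0}) (_ : α < β), transOsc f α x := by
  rw [transOsc, Ordinal.limitRecOn_limit _ _ _ _ hβ]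
  rfl

/-- `U` is a closed relative neighborhood in `L`: a closed set contained in `L` whose interior
relative to `L` is nonempty. (For closed `L`, closed in `L` and closed in `X` are the same.) -/
def IsClosedRelNhd {X : Type*} [TopologicalSpace X] (U L : Set X) : Prop :=
  U ⊆ L ∧ IsClosed U ∧ (interior ((↑) ⁻¹' U : Set L)).Nonempty

end

/-!
The class `DSC K` consists of the functions `f` for which some real-valued `u` makes `u + f` and
`u - f` lower semicontinuous (`exists_controlsVariation_of_mem_DSC`,
`mem_DSC_of_controlsVariation`); `ControlsVariation` is this condition. A locally bounded version
of it is the existence of a bounded `φ` with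
`limsup_{y → x} (|f y - f x| + φ y) ≤ φ x` (`OscMajorant`). Such a `φ` dominates every transfinite
oscillation of `f`. Conversely, on a second countable space the increasing family of upper
semicontinuous functions `osc_α f` is constant from some countable ordinal on, so a uniform bound on
all countable oscillations provides a majorant (`exists_oscMajorant`).

Functions with bounded majorants on the members of a countable closed cover are in `DSC`
(`mem_DSC_of_iUnion_closed`), and by an exhaustion argument it is enough to find, in every nonempty
closed set `L`, a relatively open piece on which `f` has a bounded majorant
(`mem_DSC_of_forall_closed`).

To find this piece, note that for each countable `α` the hypothesis provides a relatively open set,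
which may be taken basic, a first index `n` of the subsequence and a bound `N` on the sum of the
norms. There are countably many such triples and the conditions become weaker as `α` decreases, so
one triple serves all countable `α` (`exists_forall_subseqOscBounded`). There
`osc_α f ≤ osc_α (F n) + N` for all `α`, by countable subadditivity of the oscillations along
uniformly convergent series (`transOsc_sub_le_tsum`). Since `F n` is in `DSC`, Baire's theorem in
`L` bounds `osc_α (F n)` uniformly in `α` on a smaller relatively open set, and stabilization
applies.
-/

/-! ### Upper semicontinuous envelopes -/

section Envelope

variable {X Y : Type*} [TopologicalSpace X] [TopologicalSpace Y]

theorem le_usEnv (g : X → ENNReal) (x : X) : g x ≤ usEnv g x := by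
  rw [usEnv_eq_iInf]
  exact le_iInf fun V => le_iSup₂_of_le x V.2.1 le_rfl

theorem usEnv_mono {g h : X → ENNReal} (hgh : ∀ x, g x ≤ h x) (x : X) : usEnv g x ≤ usEnv h x :=
  limsup_le_limsup (Eventually.of_forall hgh)

theorem usEnv_le_of_forall_le {g : X → ENNReal} {c : ENNReal} (h : ∀ x, g x ≤ c) (x : X) :
    usEnv g x ≤ c :=
  limsup_le_of_le (by isBoundedDefault) (Eventually.of_forall h)

theorem usEnv_add_le (g h : X → ENNReal) (x : X) :
    usEnv (fun y => g y + h y) x ≤ usEnv g x + usEnv h x := by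
  simp only [usEnv_eq_iInf]
  rw [ENNReal.iInf_add_iInf]
  · exact le_iInf fun V => iInf_le_of_le V <| iSup₂_le fun y hy =>
      add_le_add (le_iSup₂_of_le y hy le_rfl) (le_iSup₂_of_le y hy le_rfl)
  · intro V W
    refine ⟨⟨V.1 ∩ W.1, ⟨V.2.1, W.2.1⟩, V.2.2.inter W.2.2⟩, add_le_add ?_ ?_⟩
    · exact iSup₂_le fun y hy => le_iSup₂_of_le y hy.1 le_rfl
    · exact iSup₂_le fun y hy => le_iSup₂_of_le y hy.2 le_rfl

theorem usEnv_usEnv (g : X → ENNReal) (x : X) : usEnv (usEnv g) x = usEnv g x := by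
  refine le_antisymm ?_ (le_usEnv _ x)
  conv_rhs => rw [usEnv_eq_iInf]
  refine le_iInf fun V => ?_
  rw [usEnv_eq_iInf]
  refine iInf_le_of_le V (iSup₂_le fun y hy => ?_)
  rw [usEnv_eq_iInf]
  exact iInf_le_of_le ⟨V.1, hy, V.2.2⟩ le_rfl

theorem usEnv_comp_le {e : Y → X} (he : Continuous e) (g : X → ENNReal) (y : Y) :
    usEnv (fun z => g (e z)) y ≤ usEnv g (e y) := by
  simp only [usEnv_eq_iInf]
  exact le_iInf fun V => iInf_le_of_le ⟨e ⁻¹' V.1, V.2.1, V.2.2.preimage he⟩ <|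
    iSup₂_le fun z hz => le_iSup₂_of_le (e z) hz le_rfl

end Envelope

/-! ### Calculus of transfinite oscillations -/

section TransfiniteOscillation

variable {X Y : Type*} [TopologicalSpace X] [TopologicalSpace Y]

theorem transOsc_mono (f : X → ℝ) {α β : Ordinal.{0}} (h : α ≤ β) (x : X) :
    transOsc f α x ≤ transOsc f β x := by
  induction β using Ordinal.limitRecOn with
  | zero => rw [nonpos_iff_eq_zero.1 h]
  | add_one β ih =>
    rcases h.lt_or_eq with h | rfl
    · refine (ih (Order.lt_add_one_iff.1 h)).trans ?_
      rw [transOsc_add_one]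
      refine le_trans ?_ (le_usEnv _ x)
      refine le_trans ?_ (le_usEnv _ x)
      exact le_add_self
    · exact le_rfl
  | limit β hβ ih =>
    rcases h.lt_or_eq with h | rfl
    · rw [transOsc_limit f β hβ]
      refine le_trans ?_ (le_usEnv _ x)
      exact le_iSup₂_of_le α h le_rfl
    · exact le_rfl

theorem usEnv_transOsc (f : X → ℝ) (α : Ordinal.{0}) (x : X) :
    usEnv (transOsc f α) x = transOsc f α x := by
  induction α using Ordinal.limitRecOn with
  | zero =>
    rw [transOsc_zero]
    exact nonpos_iff_eq_zero.1 (usEnv_le_of_forall_le (fun _ => le_rfl) x)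
  | add_one β ih => rw [transOsc_add_one, usEnv_usEnv]
  | limit β hβ ih => rw [transOsc_limit f β hβ, usEnv_usEnv]

/-- Composition with a continuous map, such as an inclusion of subspaces, does not increase the
oscillations. -/
theorem transOsc_comp_le {e : Y → X} (he : Continuous e) (f : X → ℝ) (α : Ordinal.{0}) (y : Y) :
    transOsc (fun z => f (e z)) α y ≤ transOsc f α (e y) := by
  induction α using Ordinal.limitRecOn generalizing y with
  | zero => simp [transOsc_zero]
  | add_one β ih =>
    rw [transOsc_add_one, transOsc_add_one]
    refine le_trans (usEnv_mono (fun y => ?_) y) (usEnv_comp_le he _ y)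
    exact le_trans (usEnv_mono (fun z => add_le_add_right (ih z) _) y) (usEnv_comp_le he _ y)
  | limit β hβ ih =>
    rw [transOsc_limit _ β hβ, transOsc_limit _ β hβ]
    refine le_trans (usEnv_mono (fun y => ?_) y) (usEnv_comp_le he _ y)
    exact iSup₂_mono fun α hα => ih α hα y

theorem transOsc_add_le (f g : X → ℝ) (α : Ordinal.{0}) (x : X) :
    transOsc (fun y => f y + g y) α x ≤ transOsc f α x + transOsc g α x := by
  induction α using Ordinal.limitRecOn generalizing x with
  | zero => simp [transOsc_zero]
  | add_one β ih =>
    simp only [transOsc_add_one]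
    refine le_trans (usEnv_mono (fun x => ?_) x) (usEnv_add_le _ _ x)
    refine le_trans (usEnv_mono (fun y => ?_) x) (usEnv_add_le _ _ x)
    rw [add_add_add_comm, ← ENNReal.ofReal_add (abs_nonneg _) (abs_nonneg _)]
    refine add_le_add (ENNReal.ofReal_le_ofReal ?_) (ih y)
    rw [add_sub_add_comm]
    exact abs_add_le _ _
  | limit β hβ ih =>
    simp only [transOsc_limit _ β hβ]
    refine le_trans (usEnv_mono (fun x => ?_) x) (usEnv_add_le _ _ x)
    exact iSup₂_le fun α hα => (ih α hα x).trans
      (add_le_add (le_iSup₂_of_le α hα le_rfl) (le_iSup₂_of_le α hα le_rfl))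

theorem transOsc_add_one_le_of_abs_le {f : X → ℝ} {α : Ordinal.{0}} {ε : ℝ} {c : ENNReal}
    (hf : ∀ x, |f x| ≤ ε) (hc : ∀ x, transOsc f α x ≤ c) (x : X) :
    transOsc f (α + 1) x ≤ ENNReal.ofReal (2 * ε) + c := by
  rw [transOsc_add_one]
  refine usEnv_le_of_forall_le (fun x => usEnv_le_of_forall_le (fun y => ?_) x) x
  refine add_le_add (ENNReal.ofReal_le_ofReal ?_) (hc y)
  linarith [abs_sub (f y) (f x), hf x, hf y]

/-- The oscillations of `f - G n` are controlled by the tail of the series of the suprema of the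
oscillations of the increments of a uniformly convergent sequence. Uniform convergence makes the
remainder `f - G m` negligible at each successor step, so that only finite subadditivity is used. -/
theorem transOsc_sub_le_tsum {f : X → ℝ} {G : ℕ → X → ℝ} (hG : TendstoUniformly G f atTop)
    (α : Ordinal.{0}) (n : ℕ) (x : X) :
    transOsc (fun y => f y - G n y) α x ≤
      ∑' j, ⨆ z, transOsc (fun y => G (n + j + 1) y - G (n + j) y) α z := by
  induction α using Ordinal.limitRecOn generalizing n x with
  | zero => simp [transOsc_zero]
  | add_one α ih =>
    let S : ℕ → ENNReal := fun j =>
      ⨆ z, transOsc (fun y => G (n + j + 1) y - G (n + j) y) (α + 1) z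
    change _ ≤ ∑' j, S j
    -- Only finitely many increments are split off; the remainder is uniformly small.
    have tele : ∀ m, transOsc (fun y => f y - G n y) (α + 1) x ≤
        (∑ j ∈ Finset.range m, S j) +
        transOsc (fun y => f y - G (n + m) y) (α + 1) x := by
      intro m
      induction m with
      | zero => simp
      | succ m ihm =>
        refine ihm.trans ?_
        rw [Finset.sum_range_succ, add_assoc]
        refine add_le_add_right ?_ _
        have := transOsc_add_le (fun y => G (n + m + 1) y - G (n + m) y)
          (fun y => f y - G (n + (m + 1)) y) (α + 1) x
        refine le_trans (le_of_eq ?_) (this.trans (add_le_add_left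
          (le_iSup (fun z => transOsc (fun y => G (n + m + 1) y - G (n + m) y) (α + 1) z) x) _))
        congr 1
        ext y
        rw [← add_assoc]
        ring
    refine ENNReal.le_of_forall_pos_le_add fun ε hε _ => ?_
    have hε2 : (0 : ℝ) < ε / 2 := by positivity
    obtain ⟨m, hm⟩ := eventually_atTop.1 (Metric.tendstoUniformly_iff.1 hG (ε / 2) hε2)
    refine (tele m).trans ?_
    have hsmall : ∀ y, |f y - G (n + m) y| ≤ ε / 2 := fun y =>
      (hm (n + m) (Nat.le_add_left m n) y).le
    have hrem := transOsc_add_one_le_of_abs_le hsmall (fun y => ih (n + m) y) x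
    rw [mul_div_cancel₀ _ two_ne_zero, ENNReal.ofReal_coe_nnreal] at hrem
    have htail : ∑' j, (⨆ z, transOsc (fun y => G (n + m + j + 1) y - G (n + m + j) y) α z) ≤
        ∑' j, S (j + m) := by
      refine ENNReal.tsum_le_tsum fun j => iSup_mono fun z => ?_
      rw [show n + m + j = n + (j + m) by omega]
      exact transOsc_mono _ le_self_add z
    calc (∑ j ∈ Finset.range m, S j) + transOsc (fun y => f y - G (n + m) y) (α + 1) x
        ≤ (∑ j ∈ Finset.range m, S j) + (ε + ∑' j, S (j + m)) :=
          add_le_add_right (hrem.trans (add_le_add_right htail _)) _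
      _ = (∑' j, S j) + ε := by
          rw [← ENNReal.summable.sum_add_tsum_nat_add' (f := S) (k := m), add_assoc,
            add_comm (ε : ENNReal)]
  | limit β hβ ih =>
    rw [transOsc_limit _ β hβ]
    refine usEnv_le_of_forall_le (fun x => iSup₂_le fun α hα => (ih α hα n x).trans ?_) x
    exact ENNReal.tsum_le_tsum fun j => iSup_mono fun z => transOsc_mono _ hα.le z

end TransfiniteOscillation

/-! ### Majorants and stabilization at a countable ordinal -/

section Majorant

variable {X Y : Type*} [TopologicalSpace X] [TopologicalSpace Y]

/-- `φ` is a fixed-point bound for the recursion step of the transfinite oscillations: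
`limsup_{y → x} (|f y - f x| + φ y) ≤ φ x` at every `x`. For finite `φ` this says exactly that
`φ + f` and `φ - f` are upper semicontinuous. -/
def OscMajorant (f : X → ℝ) (φ : X → ENNReal) : Prop :=
  ∀ x, usEnv (fun y => ENNReal.ofReal |f y - f x| + φ y) x ≤ φ x

theorem OscMajorant.comp {f : X → ℝ} {φ : X → ENNReal} (h : OscMajorant f φ) {e : Y → X}
    (he : Continuous e) : OscMajorant (fun y => f (e y)) (fun y => φ (e y)) := fun y =>
  (usEnv_comp_le he (fun z => ENNReal.ofReal |f z - f (e y)| + φ z) y).trans (h (e y))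

/-- A majorant dominates all transfinite oscillations, including the uncountable ones. -/
theorem OscMajorant.transOsc_le {f : X → ℝ} {φ : X → ENNReal} (h : OscMajorant f φ)
    (α : Ordinal.{0}) (x : X) : transOsc f α x ≤ φ x := by
  have husc : ∀ x, usEnv φ x ≤ φ x := fun x =>
    (usEnv_mono (fun _ => le_add_self) x).trans (h x)
  induction α using Ordinal.limitRecOn generalizing x with
  | zero => simp [transOsc_zero]
  | add_one α ih =>
    rw [transOsc_add_one]
    refine le_trans (usEnv_mono (fun x => ?_) x) (husc x)
    exact (usEnv_mono (fun y => add_le_add_right (ih y) _) x).trans (h x)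
  | limit β hβ ih =>
    rw [transOsc_limit _ β hβ]
    exact le_trans (usEnv_mono (fun x => iSup₂_le fun α hα => ih α hα x) x) (husc x)

theorem exists_forall_le_lt_omega_one {ι : Type*} [Countable ι] {a : ι → Ordinal.{0}}
    (ha : ∀ i, a i < Ordinal.omega 1) : ∃ τ < Ordinal.omega 1, ∀ i, a i ≤ τ :=
  ⟨⨆ i, a i, Ordinal.iSup_lt_omega_one ha, Ordinal.le_iSup a⟩

/-- A monotone `[0, ∞]`-valued function attains its supremum over the countable ordinals. -/
theorem exists_forall_le_of_monotone_omega_one {g : Ordinal.{0} → ENNReal} (hg : Monotone g) :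
    ∃ α < Ordinal.omega 1, ∀ β < Ordinal.omega 1, g β ≤ g α := by
  have hne : (g '' Set.Iio (Ordinal.omega 1)).Nonempty := ⟨g 0, 0, Ordinal.omega_pos 1, rfl⟩
  obtain ⟨u, -, hlim, hmem⟩ := exists_seq_tendsto_sSup hne (OrderTop.bddAbove _)
  choose a ha hau using hmem
  obtain ⟨τ, hτ, haτ⟩ := exists_forall_le_lt_omega_one ha
  refine ⟨τ, hτ, fun β hβ => ?_⟩
  refine (le_sSup (Set.mem_image_of_mem g hβ)).trans (le_of_tendsto' hlim fun n => ?_)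
  rw [← hau n]
  exact hg (haτ n)

/-- On a second countable space the oscillations of `f` stabilize at a countable ordinal; hence a
bound on all countable oscillations yields a bounded majorant. -/
theorem exists_oscMajorant [SecondCountableTopology X] {f : X → ℝ} {N : ENNReal}
    (h : ∀ α < Ordinal.omega 1, ∀ x, transOsc f α x ≤ N) :
    ∃ φ, OscMajorant f φ ∧ ∀ x, φ x ≤ N := by
  have hB := TopologicalSpace.isBasis_countableBasis X
  have hstab : ∀ s : TopologicalSpace.countableBasis X, ∃ α < Ordinal.omega 1,
      ∀ β < Ordinal.omega 1, (⨆ y ∈ s.1, transOsc f β y) ≤ ⨆ y ∈ s.1, transOsc f α y := fun s =>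
    exists_forall_le_of_monotone_omega_one (g := fun α => ⨆ y ∈ s.1, transOsc f α y)
      fun α β hαβ => iSup₂_mono fun y _ => transOsc_mono f hαβ y
  choose a ha hmax using hstab
  have : Countable (TopologicalSpace.countableBasis X) :=
    (TopologicalSpace.countable_countableBasis X).to_subtype
  obtain ⟨τ, hτ, haτ⟩ := exists_forall_le_lt_omega_one ha
  have hτ1 : τ + 1 < Ordinal.omega 1 := (Cardinal.isSuccLimit_omega 1).add_one_lt hτ
  refine ⟨transOsc f τ, fun x => ?_, h τ hτ⟩
  have step : transOsc f (τ + 1) x ≤ transOsc f τ x := by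
    rw [← usEnv_transOsc f τ x, usEnv_eq_iInf]
    refine le_iInf fun V => ?_
    obtain ⟨s, hs, hxs, hsV⟩ := hB.exists_subset_of_mem_open V.2.1 V.2.2
    calc transOsc f (τ + 1) x ≤ ⨆ y ∈ s, transOsc f (τ + 1) y := le_iSup₂_of_le x hxs le_rfl
      _ ≤ ⨆ y ∈ s, transOsc f (a ⟨s, hs⟩) y := hmax ⟨s, hs⟩ _ hτ1
      _ ≤ ⨆ y ∈ s, transOsc f τ y := iSup₂_mono fun y _ => transOsc_mono f (haτ _) y
      _ ≤ ⨆ y ∈ V.1, transOsc f τ y := biSup_mono hsV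
  refine le_trans ?_ step
  rw [transOsc_add_one]
  exact le_usEnv (fun x => usEnv (fun y => ENNReal.ofReal |f y - f x| + transOsc f τ y) x) x

end Majorant

/-! ### Functions in `DSC` as differences of semicontinuous functions -/

section Control

variable {X : Type*}

/-- `u` controls the variation of `f`: both `u + f` and `u - f` are lower semicontinuous, stated
as one inequality. -/
def ControlsVariation [TopologicalSpace X] (u f : X → ℝ) : Prop :=
  ∀ x, ∀ ε > 0, ∀ᶠ y in 𝓝 x, |f y - f x| + u x ≤ u y + ε

theorem ControlsVariation.lowerSemicontinuous [TopologicalSpace X] {u f : X → ℝ}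
    (h : ControlsVariation u f) : LowerSemicontinuous u := by
  intro x a ha
  filter_upwards [h x ((u x - a) / 2) (by linarith)] with y hy
  linarith [abs_nonneg (f y - f x)]

/-- For a pointwise absolutely convergent series of continuous functions, the sum of the absolute
values controls the variation of the limit. -/
theorem exists_controlsVariation_of_mem_DSC [TopologicalSpace X] {f : X → ℝ} (hf : f ∈ DSC X) :
    ∃ u, (∀ x, 0 ≤ u x) ∧ ControlsVariation u f := by
  obtain ⟨g, hg, hs⟩ := hf
  have hdist : ∀ x n, dist (g n x) (g (n + 1) x) = |g (n + 1) x - g n x| := fun x n => by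
    rw [dist_comm, Real.dist_eq]
  have htail : ∀ x N, |f x - g N x| ≤
      (∑' n, |g (n + 1) x - g n x|) - ∑ n ∈ Finset.range N, |g (n + 1) x - g n x| := by
    intro x N
    have h := dist_le_tsum_dist_of_tendsto (f := fun n => g n x)
      (by simpa only [hdist] using hs x) (hg x) N
    rw [← (hs x).sum_add_tsum_nat_add N, add_sub_cancel_left, abs_sub_comm, ← Real.dist_eq]
    refine h.trans (le_of_eq (tsum_congr fun m => ?_))
    rw [Nat.succ_eq_add_one, hdist, Nat.add_comm N m]
  refine ⟨fun x => ∑' n, |g (n + 1) x - g n x|, fun x => tsum_nonneg fun _ => abs_nonneg _,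
    fun x ε hε => ?_⟩
  have hsum := (hs x).hasSum.tendsto_sum_nat
  obtain ⟨N, hN⟩ := (hsum.eventually (lt_mem_nhds (sub_lt_self _
    (by positivity : 0 < ε / 4)))).exists
  have hN' := htail x N
  have hcont : Continuous fun y => ∑ n ∈ Finset.range N, |g (n + 1) y - g n y| := by fun_prop
  filter_upwards [hcont.continuousAt.eventually (lt_mem_nhds (sub_lt_self _
      (by positivity : 0 < ε / 4))),
    Metric.continuousAt_iff'.1 (g N).continuous.continuousAt (ε / 4) (by positivity)] with y hy hy'
  have hy'' := htail y N
  rw [Real.dist_eq] at hy'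
  have htri : |f y - f x| ≤ |f y - g N y| + |g N y - g N x| + |f x - g N x| := by
    rw [abs_sub_comm (f x)]
    exact (abs_sub_le _ (g N x) _).trans (add_le_add_left (abs_sub_le _ (g N y) _) _)
  linarith

/-- Baire's approximation of a nonnegative lower semicontinuous function from below, by
inf-convolution with `n * dist`. -/
theorem exists_monotone_tendsto_of_lowerSemicontinuous [PseudoMetricSpace X] {u : X → ℝ}
    (hu : LowerSemicontinuous u) (h0 : ∀ x, 0 ≤ u x) :
    ∃ g : ℕ → C(X, ℝ), ∀ x, Monotone (fun n => g n x) ∧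
      Tendsto (fun n => g n x) atTop (𝓝 (u x)) := by
  have hb : ∀ (n : ℕ) x, BddBelow (Set.range fun y => u y + n * dist x y) := fun n x =>
    ⟨0, by rintro _ ⟨y, rfl⟩; exact add_nonneg (h0 y) (by positivity)⟩
  have hle : ∀ (n : ℕ) x, (⨅ y, u y + n * dist x y) ≤ u x := fun n x =>
    (ciInf_le (hb n x) x).trans (by simp)
  have hlip : ∀ n : ℕ, LipschitzWith n fun x => ⨅ y, u y + n * dist x y := by
    refine fun n => LipschitzWith.of_le_add_mul _ fun x z => ?_
    have : Nonempty X := ⟨x⟩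
    rw [← sub_le_iff_le_add]
    refine le_ciInf fun y => ?_
    have h1 := ciInf_le (hb n x) y
    have h2 := mul_le_mul_of_nonneg_left (dist_triangle x z y) (Nat.cast_nonneg (α := ℝ) n)
    simp only [NNReal.coe_natCast] at *
    linarith
  refine ⟨fun n => ⟨_, (hlip n).continuous⟩, fun x => ?_⟩
  have : Nonempty X := ⟨x⟩
  refine ⟨fun m n hmn => ciInf_mono (hb m x) fun y => ?_, ?_⟩
  · gcongr
  · refine Metric.tendsto_atTop.2 fun ε hε => ?_
    obtain ⟨δ, hδ, hball⟩ := Metric.eventually_nhds_iff.1 (hu x (u x - ε / 2) (by linarith))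
    obtain ⟨N, hN⟩ := exists_nat_gt (u x / δ)
    refine ⟨N, fun n hn => ?_⟩
    have hlow : u x - ε / 2 ≤ ⨅ y, u y + n * dist x y := by
      refine le_ciInf fun y => ?_
      by_cases hy : dist y x < δ
      · have h1 := hball hy
        have h2 : 0 ≤ (n : ℝ) * dist x y := by positivity
        linarith
      · rw [dist_comm, not_lt] at hy
        have h1 : u x < n * δ := (div_lt_iff₀ hδ).1 (hN.trans_le (by exact_mod_cast hn))
        have h2 := mul_le_mul_of_nonneg_left hy (Nat.cast_nonneg (α := ℝ) n)
        linarith [h0 y]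
    have hup := hle n x
    simp only [ContinuousMap.coe_mk, Real.dist_eq]
    rw [abs_lt]
    constructor <;> linarith

/-- The function `f = ((u + f) - (u - f)) / 2` is half the difference of two nonnegative lower
semicontinuous functions, and the increments of the increasing approximations of these are
summable. -/
theorem mem_DSC_of_controlsVariation [TopologicalSpace X]
    [TopologicalSpace.PseudoMetrizableSpace X] {u f : X → ℝ} (h : ControlsVariation u f)
    (hfu : ∀ x, |f x| ≤ u x) : f ∈ DSC X := by
  let := TopologicalSpace.pseudoMetrizableSpacePseudoMetric X
  have hp : LowerSemicontinuous fun x => u x + f x := by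
    intro x a ha
    filter_upwards [h x ((u x + f x - a) / 2) (by linarith)] with y hy
    linarith [neg_abs_le (f y - f x)]
  have hm : LowerSemicontinuous fun x => u x - f x := by
    intro x a ha
    filter_upwards [h x ((u x - f x - a) / 2) (by linarith)] with y hy
    linarith [le_abs_self (f y - f x)]
  obtain ⟨p, hp⟩ := exists_monotone_tendsto_of_lowerSemicontinuous hp
    fun x => by linarith [neg_abs_le (f x), hfu x]
  obtain ⟨q, hq⟩ := exists_monotone_tendsto_of_lowerSemicontinuous hm
    fun x => by linarith [le_abs_self (f x), hfu x]
  have hsum : ∀ (a : ℕ → ℝ) (l : ℝ), Monotone a → Tendsto a atTop (𝓝 l) →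
      Summable fun n => a (n + 1) - a n := by
    intro a l ha hl
    refine summable_of_sum_range_le (c := l - a 0) (fun n => sub_nonneg.2 (ha n.le_succ))
      fun n => ?_
    rw [Finset.sum_range_sub]
    linarith [ha.ge_of_tendsto hl n]
  refine ⟨fun n => (1 / 2 : ℝ) • (p n - q n), fun x => ?_, fun x => ?_⟩
  · have := ((hp x).2.sub (hq x).2).const_mul (1 / 2)
    rw [show 1 / 2 * (u x + f x - (u x - f x)) = f x by ring] at this
    simpa using this
  · refine Summable.of_nonneg_of_le (fun _ => abs_nonneg _) (fun n => ?_)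
      ((hsum _ _ (hp x).1 (hp x).2).add (hsum _ _ (hq x).1 (hq x).2))
    have h1 := (hp x).1 n.le_succ
    have h2 := (hq x).1 n.le_succ
    simp only [ContinuousMap.smul_apply, ContinuousMap.sub_apply, smul_eq_mul,
      Nat.succ_eq_add_one] at *
    rw [abs_le]
    constructor <;> linarith

end Control

/-! ### Gluing along countable closed covers -/

section Gluing

variable {X : Type*} [TopologicalSpace X]

/-- `f` is bounded on `S` and its restriction to `S` has a bounded majorant, with a common integer
bound. Equivalently, `f|S` is a difference of bounded semicontinuous functions on `S`. -/
def HasBoundedMajorantOn (f : X → ℝ) (S : Set X) : Prop :=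
  ∃ (m : ℕ) (φ : S → ENNReal), OscMajorant (fun y : S => f y) φ ∧ (∀ y, φ y ≤ m) ∧
    ∀ y : S, |f y| ≤ m

theorem hasBoundedMajorantOn_empty (f : X → ℝ) : HasBoundedMajorantOn f ∅ :=
  ⟨0, fun _ => 0, fun x => x.2.elim, fun x => x.2.elim, fun x => x.2.elim⟩

/-- Where a control `u` is at most `m`, the difference `m - u` is a majorant. -/
theorem ControlsVariation.oscMajorant_ofReal_sub {u f : X → ℝ} (h : ControlsVariation u f)
    {S : Set X} {m : ℝ} (hS : ∀ x ∈ S, u x ≤ m) :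
    OscMajorant (fun y : S => f y) fun y => ENNReal.ofReal (m - u y) := by
  intro x
  refine ENNReal.le_of_forall_pos_le_add fun ε hε _ => ?_
  refine limsup_le_of_le (by isBoundedDefault) ?_
  filter_upwards [continuous_subtype_val.continuousAt.eventually (h x ε hε)] with y hy
  rw [← ENNReal.ofReal_add (abs_nonneg _) (sub_nonneg.2 (hS y y.2)), ← ENNReal.ofReal_coe_nnreal,
    ← ENNReal.ofReal_add (sub_nonneg.2 (hS x x.2)) ε.coe_nonneg]
  exact ENNReal.ofReal_le_ofReal (by linarith)

/-- Conversely, `m - φ` is a bounded control on `S`; it is extended to `X` by the value `0`, which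
plays no role since the estimate only concerns points of `S`. -/
theorem HasBoundedMajorantOn.exists_control {f : X → ℝ} {S : Set X}
    (h : HasBoundedMajorantOn f S) : ∃ (m : ℕ) (u : X → ℝ),
      (∀ x ∈ S, |f x| ≤ m) ∧ (∀ x, 0 ≤ u x ∧ u x ≤ m) ∧
      ∀ x ∈ S, ∀ ε > 0, ∀ᶠ y in 𝓝 x, y ∈ S → |f y - f x| + u x ≤ u y + ε := by
  classical
  obtain ⟨m, φ, hφ, hm, hf⟩ := h
  have hfin : ∀ y, φ y ≠ ⊤ := fun y => ne_top_of_le_ne_top (ENNReal.natCast_ne_top m) (hm y)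
  have hreal : ∀ y, (φ y).toReal ≤ m := fun y => by
    simpa using ENNReal.toReal_mono (ENNReal.natCast_ne_top m) (hm y)
  refine ⟨m, fun x => if hx : x ∈ S then m - (φ ⟨x, hx⟩).toReal else 0, fun x hx => hf ⟨x, hx⟩,
    fun x => ?_, fun x hx ε hε => ?_⟩
  · by_cases hx : x ∈ S
    · simp only [hx, dif_pos]
      exact ⟨by linarith [hreal ⟨x, hx⟩], by linarith [(φ ⟨x, hx⟩).toReal_nonneg]⟩
    · simp [hx]
  · have hlt : usEnv (fun y : S => ENNReal.ofReal |f y - f x| + φ y) ⟨x, hx⟩ <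
        φ ⟨x, hx⟩ + ENNReal.ofReal ε :=
      (hφ ⟨x, hx⟩).trans_lt (ENNReal.lt_add_right (hfin _) (by simpa using hε))
    have hev := eventually_lt_of_limsup_lt hlt
    rw [nhds_subtype_eq_comap, eventually_comap] at hev
    filter_upwards [hev] with y hy hyS
    have h1 := (hy ⟨y, hyS⟩ rfl).le
    have h2 := ENNReal.toReal_mono (ENNReal.add_ne_top.2 ⟨hfin _, ENNReal.ofReal_ne_top⟩) h1
    rw [ENNReal.toReal_add ENNReal.ofReal_ne_top (hfin _), ENNReal.toReal_add (hfin _)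
      ENNReal.ofReal_ne_top, ENNReal.toReal_ofReal (abs_nonneg _), ENNReal.toReal_ofReal hε.le] at h2
    simp only [hx, hyS, dif_pos]
    linarith

/-- Gluing along a countable closed cover. Give a point the index `i x` of the first member that
contains it. Nearby points have an index at least `i x`, since the earlier members are closed, and
constants that grow fast enough with the index make up for the lack of control between different
members. -/
theorem mem_DSC_of_iUnion_closed [TopologicalSpace.PseudoMetrizableSpace X] {f : X → ℝ}
    {C : ℕ → Set X} (hC : ∀ i, IsClosed (C i)) (hcov : ∀ x, ∃ i, x ∈ C i)
    (hf : ∀ i, HasBoundedMajorantOn f (C i)) : f ∈ DSC X := by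
  classical
  choose m u hfm hum hu using fun i => (hf i).exists_control
  let c : ℕ → ℝ := fun k => m k + ∑ j ∈ Finset.range k, 3 * (m j : ℝ)
  have hc : ∀ i k, i < k → c i + 2 * m i + m k ≤ c k := by
    intro i k hik
    have h1 : ∑ j ∈ Finset.range (i + 1), 3 * (m j : ℝ) ≤ ∑ j ∈ Finset.range k, 3 * (m j : ℝ) :=
      Finset.sum_le_sum_of_subset_of_nonneg (Finset.range_mono hik) fun j _ _ => by positivity
    rw [Finset.sum_range_succ] at h1
    simp only [c]
    linarith
  let i : X → ℕ := fun x => Nat.find (hcov x)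
  have hi : ∀ x, x ∈ C (i x) := fun x => Nat.find_spec (hcov x)
  refine mem_DSC_of_controlsVariation (u := fun x => c (i x) + u (i x) x) (fun x ε hε => ?_)
    fun x => ?_
  · have hfar : ∀ᶠ y in 𝓝 x, ∀ j ∈ Finset.range (i x), y ∉ C j :=
      (Filter.eventually_all_finset _).2 fun j hj =>
        (hC j).isOpen_compl.eventually_mem (Nat.find_min (hcov x) (Finset.mem_range.1 hj))
    filter_upwards [hfar, hu (i x) x (hi x) ε hε] with y hy hyu
    have hle : i x ≤ i y := by
      by_contra hlt
      exact hy (i y) (Finset.mem_range.2 (not_le.1 hlt)) (hi y)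
    rcases hle.eq_or_lt with heq | hlt
    · have := hyu (heq ▸ hi y)
      rw [← heq]
      linarith
    · have h1 := hc _ _ hlt
      have h2 := hfm _ x (hi x)
      have h3 := hfm _ y (hi y)
      have h4 := abs_sub (f y) (f x)
      linarith [(hum (i x) x).2, (hum (i y) y).1]
  · have h1 : (0 : ℝ) ≤ ∑ j ∈ Finset.range (i x), 3 * (m j : ℝ) :=
      Finset.sum_nonneg fun j _ => by positivity
    have h2 := hfm _ x (hi x)
    have h3 := (hum (i x) x).1
    simp only [c]
    linarith

end Gluing

/-! ### Localization on closed sets -/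

section Localization

/-- Countable pigeonhole principle for `ω₁`. -/
theorem exists_forall_lt_omega_one {ι : Type*} [Countable ι] {Q : ι → Ordinal.{0} → Prop}
    (hmono : ∀ i α β, α ≤ β → Q i β → Q i α) (h : ∀ α < Ordinal.omega 1, ∃ i, Q i α) :
    ∃ i, ∀ α < Ordinal.omega 1, Q i α := by
  by_contra! hcon
  choose a ha hQ using hcon
  obtain ⟨τ, hτ, haτ⟩ := exists_forall_le_lt_omega_one ha
  obtain ⟨i, hi⟩ := h τ hτ
  exact hQ i (hmono i _ _ (haτ i) hi)

variable {X : Type*} [TopologicalSpace X]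

/-- A function with a bounded majorant is locally bounded, so near any point a majorant also
bounds the function. -/
theorem OscMajorant.exists_isOpen_bounded {f : X → ℝ} {S : Set X} {φ : S → ENNReal} {N : ℕ}
    (hφ : OscMajorant (fun y : S => f y) φ) (hN : ∀ y, φ y ≤ N) {x : X} (hx : x ∈ S) :
    ∃ V, IsOpen V ∧ x ∈ V ∧ ∀ T ⊆ V ∩ S, HasBoundedMajorantOn f T := by
  have hlt : usEnv (fun y : S => ENNReal.ofReal |f y - f x| + φ y) ⟨x, hx⟩ < (N + 1 : ℕ) :=
    ((hφ ⟨x, hx⟩).trans (hN _)).trans_lt (by exact_mod_cast N.lt_succ_self)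
  have hev := eventually_lt_of_limsup_lt hlt
  rw [nhds_subtype_eq_comap, eventually_comap] at hev
  obtain ⟨V, hV, hVo, hxV⟩ := eventually_nhds_iff.1 hev
  obtain ⟨m, hm⟩ := exists_nat_ge (|f x| + (N + 1))
  refine ⟨V, hVo, hxV, fun T hT => ⟨m, fun y => φ ⟨y, (hT y.2).2⟩,
    hφ.comp (continuous_inclusion fun y hy => (hT hy).2), fun y => (hN _).trans ?_, fun y => ?_⟩⟩
  · have : (N : ℝ) ≤ m := by linarith [abs_nonneg (f x)]
    exact_mod_cast this
  · have h1 := (le_self_add.trans_lt (hV y (hT y.2).1 ⟨y, (hT y.2).2⟩ rfl)).le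
    rw [← ENNReal.ofReal_natCast, ENNReal.ofReal_le_ofReal_iff (by positivity)] at h1
    have h2 := abs_sub_abs_le_abs_sub (f y) (f x)
    push_cast at h1
    linarith

/-- It suffices to find, in every nonempty closed set, a relative neighborhood where `f` has a
bounded majorant: by second countability the union of all open sets covered by countably many good
closed sets is again such a set, and its complement must be empty. -/
theorem mem_DSC_of_forall_closed [SecondCountableTopology X]
    [TopologicalSpace.PseudoMetrizableSpace X] {f : X → ℝ}
    (h : ∀ L : Set X, IsClosed L → L.Nonempty → ∃ V C : Set X, IsOpen V ∧ (V ∩ L).Nonempty ∧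
      IsClosed C ∧ V ∩ L ⊆ C ∧ HasBoundedMajorantOn f C) : f ∈ DSC X := by
  have hB := TopologicalSpace.isBasis_countableBasis X
  let good : Set (Set X) := {C | IsClosed C ∧ HasBoundedMajorantOn f C}
  let 𝒮 := {s ∈ TopologicalSpace.countableBasis X | ∃ 𝒞 ⊆ good, 𝒞.Countable ∧ s ⊆ ⋃₀ 𝒞}
  have h𝒮 : 𝒮.Countable := (TopologicalSpace.countable_countableBasis X).mono fun s hs => hs.1
  have h𝒮c : ∀ s : 𝒮, ∃ 𝒞 ⊆ good, 𝒞.Countable ∧ s.1 ⊆ ⋃₀ 𝒞 := fun s => s.2.2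
  choose 𝒞 hgood hcount hcover using h𝒮c
  have := h𝒮.to_subtype
  have hWcov : ⋃₀ 𝒮 ⊆ ⋃₀ ⋃ s, 𝒞 s := by
    rintro x ⟨s, hs, hx⟩
    obtain ⟨C, hC, hxC⟩ := hcover ⟨s, hs⟩ hx
    exact ⟨C, Set.mem_iUnion.2 ⟨⟨s, hs⟩, hC⟩, hxC⟩
  have hW : ⋃₀ 𝒮 = Set.univ := by
    by_contra hne
    obtain ⟨V, C, hV, ⟨x, hxV, hxL⟩, hC, hVC, hfC⟩ := h (⋃₀ 𝒮)ᶜ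
      (isOpen_sUnion fun s hs => hB.isOpen hs.1).isClosed_compl (Set.nonempty_compl.2 hne)
    obtain ⟨s, hs, hxs, hsV⟩ := hB.exists_subset_of_mem_open hxV hV
    refine hxL ⟨s, ⟨hs, insert C (⋃ s, 𝒞 s), ?_, (Set.countable_iUnion hcount).insert C, ?_⟩, hxs⟩
    · exact Set.insert_subset ⟨hC, hfC⟩ (Set.iUnion_subset hgood)
    · intro y hy
      rw [Set.sUnion_insert]
      by_cases hyW : y ∈ ⋃₀ 𝒮
      · exact Or.inr (hWcov hyW)
      · exact Or.inl (hVC ⟨hsV hy, hyW⟩)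
  -- The empty set makes the countable family nonempty, so that a sequence enumerates it.
  have hempty : (∅ : Set X) ∈ good := ⟨isClosed_empty, hasBoundedMajorantOn_empty f⟩
  obtain ⟨C, hC⟩ := ((Set.countable_iUnion hcount).insert (∅ : Set X)).exists_eq_range
    (Set.insert_nonempty _ _)
  have hCgood : ∀ i, C i ∈ good := fun i =>
    Set.insert_subset hempty (Set.iUnion_subset hgood) (hC ▸ Set.mem_range_self i)
  refine mem_DSC_of_iUnion_closed (fun i => (hCgood i).1) (fun x => ?_) fun i => (hCgood i).2
  obtain ⟨D, hD, hxD⟩ := hWcov (hW ▸ Set.mem_univ x)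
  obtain ⟨i, rfl⟩ : D ∈ Set.range C := hC ▸ Set.mem_insert_of_mem _ hD
  exact ⟨i, hxD⟩

/-- `f` is, on `S`, the uniform limit of a sequence `F (φ j)` that starts at `F n` and has increments
whose oscillations of order `α` have suprema with sum at most `N`. The indices `φ` need not
increase, since this plays no role in the estimates. -/
def SubseqOscBounded (f : X → ℝ) (F : ℕ → X → ℝ) (S : Set X) (n N : ℕ) (α : Ordinal.{0}) : Prop :=
  ∃ φ : ℕ → ℕ, φ 0 = n ∧ TendstoUniformlyOn (fun j => F (φ j)) f atTop S ∧
    ∑' j, (⨆ x : S, transOsc (fun y : S => F (φ (j + 1)) y - F (φ j) y) α x) ≤ N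

theorem SubseqOscBounded.mono_ordinal {f : X → ℝ} {F : ℕ → X → ℝ} {S : Set X} {n N : ℕ}
    {α β : Ordinal.{0}} (hαβ : α ≤ β) (h : SubseqOscBounded f F S n N β) :
    SubseqOscBounded f F S n N α := by
  obtain ⟨φ, h0, hφ, hN⟩ := h
  exact ⟨φ, h0, hφ, le_trans
    (ENNReal.tsum_le_tsum fun j => iSup_mono fun x => transOsc_mono _ hαβ x) hN⟩

theorem SubseqOscBounded.mono_set {f : X → ℝ} {F : ℕ → X → ℝ} {S T : Set X} {n N : ℕ}
    {α : Ordinal.{0}} (hTS : T ⊆ S) (h : SubseqOscBounded f F S n N α) :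
    SubseqOscBounded f F T n N α := by
  obtain ⟨φ, h0, hφ, hN⟩ := h
  refine ⟨φ, h0, hφ.mono hTS, le_trans (ENNReal.tsum_le_tsum fun j => iSup_le fun y => ?_) hN⟩
  let g : S → ℝ := fun y => F (φ (j + 1)) y - F (φ j) y
  have hcomp := transOsc_comp_le (continuous_inclusion hTS) g α y
  exact hcomp.trans (le_iSup (transOsc g α) (Set.inclusion hTS y))

theorem SubseqOscBounded.transOsc_le {f : X → ℝ} {F : ℕ → X → ℝ} {S : Set X} {n N : ℕ}
    {α : Ordinal.{0}} (h : SubseqOscBounded f F S n N α) (x : S) :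
    transOsc (fun y : S => f y) α x ≤ transOsc (fun y : S => F n y) α x + N := by
  obtain ⟨φ, rfl, hφ, hN⟩ := h
  have hlim : TendstoUniformly (fun j (y : S) => F (φ j) y) (fun y => f y) atTop :=
    tendstoUniformlyOn_iff_tendstoUniformly_comp_coe.1 hφ
  have hrem := (transOsc_sub_le_tsum hlim α 0 x).trans (by simpa only [zero_add] using hN)
  have hadd := transOsc_add_le (fun y : S => F (φ 0) y) (fun y : S => f y - F (φ 0) y) α x
  simp only [add_sub_cancel] at hadd
  exact hadd.trans (add_le_add_right hrem _)

/-- The basic open set, the first index and the bound on the sum can be chosen independently of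
the countable ordinal, because there are only countably many choices. -/
theorem exists_forall_subseqOscBounded [SecondCountableTopology X] {f : X → ℝ} {F : ℕ → X → ℝ}
    {L : Set X} (h : ∀ α : Ordinal.{0}, α < Ordinal.omega 1 →
      ∃ (φ : ℕ → ℕ) (U : Set X), StrictMono φ ∧ IsClosedRelNhd U L ∧
        TendstoUniformlyOn (fun j => F (φ j)) f atTop U ∧
        (∑' j : ℕ, (⨆ x : U, transOsc (fun y : U => F (φ (j + 1)) y - F (φ j) y) α x)) < ⊤) :
    ∃ B : Set X, IsOpen B ∧ (B ∩ L).Nonempty ∧ ∃ n N : ℕ, ∀ α < Ordinal.omega 1,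
      SubseqOscBounded f F (B ∩ L) n N α := by
  have hB := TopologicalSpace.isBasis_countableBasis X
  have : Countable (TopologicalSpace.countableBasis X) :=
    (TopologicalSpace.countable_countableBasis X).to_subtype
  obtain ⟨⟨s, n, N⟩, hs⟩ := exists_forall_lt_omega_one
    (ι := TopologicalSpace.countableBasis X × ℕ × ℕ)
    (Q := fun t α => (t.1.1 ∩ L).Nonempty ∧ SubseqOscBounded f F (t.1.1 ∩ L) t.2.1 t.2.2 α)
    (fun t α β hαβ ht => ⟨ht.1, ht.2.mono_ordinal hαβ⟩) <| by
      intro α hα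
      obtain ⟨φ, U, -, ⟨-, -, x, W, ⟨hWo, hWU⟩, hxW⟩, hlim, hsum⟩ := h α hα
      obtain ⟨V, hV, rfl⟩ := isOpen_induced_iff.1 hWo
      obtain ⟨s, hs, hxs, hsV⟩ := hB.exists_subset_of_mem_open (show x.1 ∈ V from hxW) hV
      have hsU : s ∩ L ⊆ U := fun y hy => hWU (show (⟨y, hy.2⟩ : L) ∈ _ from hsV hy.1)
      obtain ⟨N, hN⟩ := ENNReal.exists_nat_gt hsum.ne
      exact ⟨⟨⟨s, hs⟩, φ 0, N⟩, ⟨x, hxs, x.2⟩,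
        SubseqOscBounded.mono_set hsU ⟨φ, rfl, hlim, hN.le⟩⟩
  exact ⟨s.1, hB.isOpen s.2, (hs 0 (Ordinal.omega_pos 1)).1, n, N, fun α hα => (hs α hα).2⟩

end Localization

/-! ### The limit function -/

theorem theorem5p2 {K : Type*} [TopologicalSpace K] [PolishSpace K]
    (f : K → ℝ) (F : ℕ → K → ℝ) (hF : ∀ n, F n ∈ DSC K)
    (h : ∀ α : Ordinal.{0}, α < Ordinal.omega 1 →
      ∀ L : Set K, IsClosed L → L.Nonempty →
        ∃ (φ : ℕ → ℕ) (U : Set K), StrictMono φ ∧ IsClosedRelNhd U L ∧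
          TendstoUniformlyOn (fun j => F (φ j)) f atTop U ∧
          (∑' j : ℕ, (⨆ x : U, transOsc (fun y : U => F (φ (j + 1)) y - F (φ j) y) α x)) < ⊤) :
    f ∈ DSC K := by
  refine mem_DSC_of_forall_closed fun L hL hLne => ?_
  obtain ⟨B, hBo, ⟨z, hzB, hzL⟩, n, N, hosc⟩ :=
    exists_forall_subseqOscBounded fun α hα => h α hα L hL hLne
  -- Baire category in `L` bounds a control of `F n` on a relatively open subset of `B ∩ L`.
  obtain ⟨u, hu0, hu⟩ := exists_controlsVariation_of_mem_DSC (hF n)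
  have := hL.polishSpace
  have hdense := dense_iUnion_interior_of_closed (X := L) (f := fun m : ℕ => {x : L | u x ≤ m})
    (fun m => (hu.lowerSemicontinuous.comp continuous_subtype_val).isClosed_preimage m)
    (Set.eq_univ_of_forall fun x => Set.mem_iUnion.2 (exists_nat_ge (u x)))
  obtain ⟨x, hxB, hx⟩ := hdense.inter_open_nonempty _ (hBo.preimage continuous_subtype_val)
    ⟨⟨z, hzL⟩, hzB⟩
  obtain ⟨m, W, ⟨hWo, hWm⟩, hxW⟩ := Set.mem_iUnion.1 hx
  obtain ⟨V, hV, rfl⟩ := isOpen_induced_iff.1 hWo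
  have hS : ∀ y ∈ V ∩ (B ∩ L), u y ≤ m := fun y hy =>
    hWm (show (⟨y, hy.2.2⟩ : L) ∈ _ from hy.1)
  have hsub : V ∩ (B ∩ L) ⊆ B ∩ L := Set.inter_subset_right
  have hbound : ∀ α < Ordinal.omega 1, ∀ y : ↥(V ∩ (B ∩ L)),
      transOsc (fun y : ↥(V ∩ (B ∩ L)) => f y) α y ≤ ((m + N : ℕ) : ENNReal) := by
    intro α hα y
    refine (((hosc α hα).mono_set hsub).transOsc_le y).trans ?_
    rw [Nat.cast_add]
    refine add_le_add_left (((hu.oscMajorant_ofReal_sub hS).transOsc_le α y).trans ?_) _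
    rw [← ENNReal.ofReal_natCast]
    exact ENNReal.ofReal_le_ofReal (sub_le_self _ (hu0 y))
  -- The bound does not depend on `α`, so the oscillations stabilize at a bounded majorant, which
  -- restricts to a closed relative neighborhood of `x` on which `f` is bounded.
  obtain ⟨φ, hφ, hφN⟩ := exists_oscMajorant hbound
  obtain ⟨O, hO, hxO, hOf⟩ := hφ.exists_isOpen_bounded hφN
    (show x.1 ∈ V ∩ (B ∩ L) from ⟨hxW, hxB, x.2⟩)
  have hnhd : O ∩ V ∩ B ∈ 𝓝 x.1 := ((hO.inter hV).inter hBo).mem_nhds ⟨⟨hxO, hxW⟩, hxB⟩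
  obtain ⟨D, hD, hDc, hDsub⟩ := exists_mem_nhds_isClosed_subset hnhd
  exact ⟨interior D, D ∩ L, isOpen_interior, ⟨x, mem_interior_iff_mem_nhds.2 hD, x.2⟩, hDc.inter hL,
    Set.inter_subset_inter_left _ interior_subset, hOf _ fun y hy =>
      ⟨(hDsub hy.1).1.1, (hDsub hy.1).1.2, (hDsub hy.1).2, hy.2⟩⟩
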